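/- Let $q\in(0,1)$. Let $C(SU_q(3))$ be the universal unital $C^*$-algebra generated by elements $u_{ij}$ ($i,j=1,2,3$) such that $\mathbf u=(u_{ij})$ is unitary and $$\sum_{i_1,i_2,i_3=1}^3 E_{i_1i_2i_3}u_{j_1i_1}u_{j_2i_2}u_{j_3i_3}=E_{j_1j_2j_3}\qquad (j_1,j_2,j_3\in\{1,2,3\}),$$ where $E_{i_1i_2i_3}=(-q)^{I(i_1,i_2,i_3)}$ if $i_1,i_2,i_3$ are distinct ($I$ being the number of inversions) and $E_{i_1i_2i_3}=0$ otherwise. Let $\mu:\mathbb T^2\to\operatorname{Aut}(C(SU_q(3)))$ be the gauge action, $\mu_z(u_{ij})=z_ju_{ij}$ with $z_3=(z_1z_2)^{-1}$, and let $C(SU_q(3)/\mathbb T^2)$ be its fixed point algebra. On $\ell^2(\mathbb N^k)$, with standard basis $|n\rangle$, $n=(n_1,\dots,n_k)\in\mathbb N^k$ (where $0\in\mathbb N$), let $a_j|n\rangle=\sqrt{1-q^{2n_j}}\,|n-e_j\rangle$ (which is $0$ if $n_j=0$) and $c_j|n\rangle=q^{n_j}|n\rangle$. For $\nu\in\mathbb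 T$ put $$T^{12}_j(\nu)=\begin{pmatrix}a_j&-q\bar\nu c_j&0\\ \nu c_j&a_j^*&0\\0&0&1\end{pmatrix},\qquad T^{23}_j(\nu)=\begin{pmatrix}1&0&0\\0&a_j&-q\bar\nu c_j\\0&\nu c_j&a_j^*\end{pmatrix},$$ and let $D(z_1,z_2)=\operatorname{diag}(z_1,z_2,(z_1z_2)^{-1})$. For $(\phi,\psi)\in\mathbb T^2$ there are six representations $\pi_*^{\phi,\psi}$ of $C(SU_q(3))$ on $\mathcal H_*$, where $\mathcal H_0=\mathbb C$, $\mathcal H_{11}=\mathcal H_{12}=\ell^2(\mathbb N)$, $\mathcal H_{21}=\mathcal H_{22}=\ell^2(\mathbb N^2)$ and $\mathcal H_3=\ell^2(\mathbb N^3)$, determined by the matrices $\pi_*^{\phi,\psi}(\mathbf u)=(\pi_*^{\phi,\psi}(u_{ij}))$ given by $$\begin{aligned} \pi_0^{\phi,\psi}(\mathbf u)&=D(\phi,\psi),\\ \pi_{11}^{\phi,\psi}(\mathbf u)&=T^{12}_1(\psi)\,D(1,-\phi\psi),\\ \pi_{12}^{\phi,\psi}(\mathbf u)&=T^{23}_1(\overline{\phi\psi})\,D(-\phi,1),\\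 \pi_{21}^{\phi,\psi}(\mathbf u)&=T^{12}_1(\phi)\,T^{23}_2(\overline{\phi\psi}),\\ \pi_{22}^{\phi,\psi}(\mathbf u)&=T^{23}_2(-\phi\psi)\,T^{12}_1(-\overline\psi),\\ \pi_3^{\phi,\psi}(\mathbf u)&=T^{23}_3(\phi)\,T^{12}_1(1)\,T^{23}_2(\overline\psi). \end{aligned}$$ Let $\rho_*^{\phi,\psi}$ be the restriction of $\pi_*^{\phi,\psi}$ to $C(SU_q(3)/\mathbb T^2)$. Then for every $*\in\{0,11,12,21,22,3\}$ and every $(\phi,\psi)\in\mathbb T^2$, the representation $\rho_*^{\phi,\psi}$ is unitarily equivalent to $\rho_*^{1,1}$. -/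

import Mathlib

open scoped ENNReal

noncomputable section

namespace QFlag

/-- The number of inverted pairs in the sequence `i, j, k`. -/
def inversions (i j k : Fin 3) : ℕ :=
  (if j < i then 1 else 0) + (if k < i then 1 else 0) + (if k < j then 1 else 0)

/-- The twisted antisymmetric symbol `E_{ijk}`. -/
def E (q : ℝ) (i j k : Fin 3) : ℂ :=
  if i ≠ j ∧ i ≠ k ∧ j ≠ k then (-(q : ℂ)) ^ inversions i j k else 0

/-- Woronowicz's defining relations of quantum `SU(3)`: the `3 × 3` matrix `u` over the unital
C*-algebra `B` is unitary and satisfies the twisted determinant relations. -/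
structure IsQuantumSU3 (q : ℝ) {B : Type*} [CStarAlgebra B]
    (u : Matrix (Fin 3) (Fin 3) B) : Prop where
  isUnitary : u ∈ unitary (Matrix (Fin 3) (Fin 3) B)
  twistedDet : ∀ j₁ j₂ j₃ : Fin 3,
    ∑ i₁, ∑ i₂, ∑ i₃, E q i₁ i₂ i₃ • (u j₁ i₁ * u j₂ i₂ * u j₃ i₃) =
      E q j₁ j₂ j₃ • (1 : B)

section lemmas
variable {q : ℝ} {B : Type*} [CStarAlgebra B]

theorem IsQuantumSU3.norm_le {u : Matrix (Fin 3) (Fin 3) B} (h : IsQuantumSU3 q u)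
    (i j : Fin 3) : ‖u i j‖ ≤ 1 := by
  let _ := CStarAlgebra.spectralOrder B
  have _ := CStarAlgebra.spectralOrderedRing B
  have h1 := congrFun (congrFun (Unitary.mem_iff.1 h.isUnitary).1 j) j
  simp only [Matrix.mul_apply, Matrix.star_apply, Matrix.one_apply_eq] at h1
  have h2 : star (u i j) * u i j ≤ 1 := by
    rw [← h1]
    exact Finset.single_le_sum (f := fun k => star (u k j) * u k j)
      (fun k _ => star_mul_self_nonneg _) (Finset.mem_univ i)
  have h3 := CStarAlgebra.norm_le_norm_of_nonneg_of_le (star_mul_self_nonneg _) h2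
  rw [CStarRing.norm_star_mul_self] at h3
  have h4 : ‖(1 : B)‖ ≤ 1 := by
    rcases subsingleton_or_nontrivial B with _ | _
    · simp [Subsingleton.elim (1 : B) 0]
    · exact CStarRing.norm_one.le
  nlinarith [norm_nonneg (u i j)]

theorem sum_swap (F : Fin 3 → Fin 3 → Fin 3 → Fin 3 → Fin 3 → Fin 3 → B) :
    ∑ a, ∑ b, ∑ c, ∑ d, ∑ e, ∑ f, F a b c d e f =
      ∑ d, ∑ e, ∑ f, ∑ a, ∑ b, ∑ c, F a b c d e f := by
  simpa only [Fintype.sum_prod_type] using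
    Finset.sum_comm (s := Finset.univ) (t := Finset.univ)
      (f := fun (p r : Fin 3 × Fin 3 × Fin 3) => F p.1 p.2.1 p.2.2 r.1 r.2.1 r.2.2)

theorem IsQuantumSU3.mul {u v : Matrix (Fin 3) (Fin 3) B} (hu : IsQuantumSU3 q u)
    (hv : IsQuantumSU3 q v) (hc : ∀ i j k l, Commute (u i j) (v k l)) :
    IsQuantumSU3 q (u * v) := by
  refine ⟨mul_mem hu.isUnitary hv.isUnitary, fun j₁ j₂ j₃ => ?_⟩
  have key : ∀ i₁ i₂ i₃, (u * v) j₁ i₁ * (u * v) j₂ i₂ * (u * v) j₃ i₃ =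
      ∑ k₁, ∑ k₂, ∑ k₃, (u j₁ k₁ * u j₂ k₂ * u j₃ k₃) * (v k₁ i₁ * v k₂ i₂ * v k₃ i₃) := by
    intro i₁ i₂ i₃
    simp only [Matrix.mul_apply]
    rw [Finset.sum_mul_sum, Finset.sum_mul]
    refine Finset.sum_congr rfl fun k₁ _ => ?_
    rw [Finset.sum_mul_sum]
    refine Finset.sum_congr rfl fun k₂ _ => Finset.sum_congr rfl fun k₃ _ => ?_
    have h1 := (hc j₂ k₂ k₁ i₁).eq
    have h2 := (hc j₃ k₃ k₁ i₁).eq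
    have h3 := (hc j₃ k₃ k₂ i₂).eq
    calc u j₁ k₁ * v k₁ i₁ * (u j₂ k₂ * v k₂ i₂) * (u j₃ k₃ * v k₃ i₃)
        = u j₁ k₁ * (v k₁ i₁ * u j₂ k₂) * (v k₂ i₂ * u j₃ k₃) * v k₃ i₃ := by
          simp only [mul_assoc]
      _ = u j₁ k₁ * u j₂ k₂ * (v k₁ i₁ * u j₃ k₃) * v k₂ i₂ * v k₃ i₃ := by
          rw [← h1, ← h3]; simp only [mul_assoc]
      _ = _ := by rw [← h2]; simp only [mul_assoc]
  simp only [key, Finset.smul_sum]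
  rw [sum_swap]
  rw [← hu.twistedDet]
  refine Finset.sum_congr rfl fun k₁ _ => Finset.sum_congr rfl fun k₂ _ =>
    Finset.sum_congr rfl fun k₃ _ => ?_
  have h := congrArg (fun x => u j₁ k₁ * u j₂ k₂ * u j₃ k₃ * x) (hv.twistedDet k₁ k₂ k₃)
  simpa only [Finset.mul_sum, mul_smul_comm, mul_one] using h

/-- The relations of Woronowicz's quantum `SU(2)`, i.e. `!![α, -q γ*; γ, α*]` is the fundamental
corepresentation. -/
structure IsQuantumSU2 (q : ℝ) (α γ : B) : Prop where
  h1 : star α * α + star γ * γ = 1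
  h2 : α * star α + (q : ℂ) ^ 2 • (γ * star γ) = 1
  h3 : γ * star γ = star γ * γ
  h4 : α * γ = (q : ℂ) • (γ * α)
  h5 : α * star γ = (q : ℂ) • (star γ * α)

/-- The quantum `SU(2)` matrix `!![α, -q γ*; γ, α*]` placed in rows and columns `1, 2`. -/
def block12 (q : ℝ) (α γ : B) : Matrix (Fin 3) (Fin 3) B :=
  !![α, -((q : ℂ) • star γ), 0;
     γ, star α, 0;
     0, 0, 1]

/-- The quantum `SU(2)` matrix `!![α, -q γ*; γ, α*]` placed in rows and columns `2, 3`. -/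
def block23 (q : ℝ) (α γ : B) : Matrix (Fin 3) (Fin 3) B :=
  !![1, 0, 0;
     0, α, -((q : ℂ) • star γ);
     0, γ, star α]

theorem block12_mem (α γ : B) (a b : Fin 3) :
    block12 q α γ a b ∈ ({0, 1, α, star α, γ, -((q : ℂ) • star γ)} : Set B) := by
  fin_cases a <;> fin_cases b <;> simp [block12]

theorem block23_mem (α γ : B) (a b : Fin 3) :
    block23 q α γ a b ∈ ({0, 1, α, star α, γ, -((q : ℂ) • star γ)} : Set B) := by
  fin_cases a <;> fin_cases b <;> simp [block23]

theorem commute_of_entries {α γ β δ : B} (h1 : Commute α β) (h2 : Commute α δ)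
    (h3 : Commute γ β) (h4 : Commute γ δ) (h5 : Commute α (star β)) (h6 : Commute α (star δ))
    (h7 : Commute γ (star β)) (h8 : Commute γ (star δ)) {x y : B}
    (hx : x ∈ ({0, 1, α, star α, γ, -((q : ℂ) • star γ)} : Set B))
    (hy : y ∈ ({0, 1, β, star β, δ, -((q : ℂ) • star δ)} : Set B)) : Commute x y := by
  have key : ∀ w ∈ ({0, 1, α, star α, γ, star γ} : Set B),
      ∀ z ∈ ({0, 1, β, star β, δ, star δ} : Set B), Commute w z := by
    have g1 := h1.star_star
    have g2 := h2.star_star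
    have g3 := h3.star_star
    have g4 := h4.star_star
    have g5 : Commute (star α) β := by simpa using h5.star_star
    have g6 : Commute (star α) δ := by simpa using h6.star_star
    have g7 : Commute (star γ) β := by simpa using h7.star_star
    have g8 : Commute (star γ) δ := by simpa using h8.star_star
    simp only [Set.mem_insert_iff, Set.mem_singleton_iff]
    rintro w (rfl | rfl | rfl | rfl | rfl | rfl) z (rfl | rfl | rfl | rfl | rfl | rfl) <;>
      first
      | exact Commute.zero_left _
      | exact Commute.zero_right _
      | exact Commute.one_left _
      | exact Commute.one_right _
      | assumption
  have hx' : ∃ w ∈ ({0, 1, α, star α, γ, star γ} : Set B), ∃ c : ℂ, x = c • w := by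
    simp only [Set.mem_insert_iff, Set.mem_singleton_iff] at hx
    rcases hx with h | h | h | h | h | h
    · exact ⟨0, by simp, 1, by rw [h, one_smul]⟩
    · exact ⟨1, by simp, 1, by rw [h, one_smul]⟩
    · exact ⟨α, by simp, 1, by rw [h, one_smul]⟩
    · exact ⟨star α, by simp, 1, by rw [h, one_smul]⟩
    · exact ⟨γ, by simp, 1, by rw [h, one_smul]⟩
    · exact ⟨star γ, by simp, -q, by rw [h, neg_smul]⟩
  have hy' : ∃ z ∈ ({0, 1, β, star β, δ, star δ} : Set B), ∃ c : ℂ, y = c • z := by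
    simp only [Set.mem_insert_iff, Set.mem_singleton_iff] at hy
    rcases hy with h | h | h | h | h | h
    · exact ⟨0, by simp, 1, by rw [h, one_smul]⟩
    · exact ⟨1, by simp, 1, by rw [h, one_smul]⟩
    · exact ⟨β, by simp, 1, by rw [h, one_smul]⟩
    · exact ⟨star β, by simp, 1, by rw [h, one_smul]⟩
    · exact ⟨δ, by simp, 1, by rw [h, one_smul]⟩
    · exact ⟨star δ, by simp, -q, by rw [h, neg_smul]⟩
  obtain ⟨w, hw, c, rfl⟩ := hx'
  obtain ⟨z, hz, d, rfl⟩ := hy'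
  exact ((key w hw z hz).smul_left c).smul_right d

/-- The scalar diagonal matrix `diag(z₁, z₂, (z₁ z₂)⁻¹)` over `B`. -/
def torus (B : Type*) [CStarAlgebra B] (z₁ z₂ : Circle) : Matrix (Fin 3) (Fin 3) B :=
  Matrix.diagonal ![(z₁ : ℂ) • 1, (z₂ : ℂ) • 1, (((z₁ * z₂)⁻¹ : Circle) : ℂ) • 1]

theorem sum_E (u : Matrix (Fin 3) (Fin 3) B) (a b c : Fin 3) :
    ∑ i₁, ∑ i₂, ∑ i₃, E q i₁ i₂ i₃ • (u a i₁ * u b i₂ * u c i₃) =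
      u a 0 * (u b 1 * u c 2) - q • (u a 0 * (u b 2 * u c 1)) - q • (u a 1 * (u b 0 * u c 2))
      + q ^ 2 • (u a 1 * (u b 2 * u c 0)) + q ^ 2 • (u a 2 * (u b 0 * u c 1))
      - q ^ 3 • (u a 2 * (u b 1 * u c 0)) := by
  have e (x : B) (n : ℕ) : (-(q : ℂ)) ^ n • x = ((-q) ^ n) • x := by
    rw [← Complex.coe_smul]; simp
  simp [Fin.sum_univ_three, E, inversions, e, mul_assoc]
  module

theorem E_smul (a b c : Fin 3) : E q a b c • (1 : B) =
    (if a ≠ b ∧ a ≠ c ∧ b ≠ c then (-q) ^ inversions a b c else 0 : ℝ) • (1 : B) := by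
  unfold E
  rw [← Complex.coe_smul]
  split_ifs <;> simp

theorem isQuantumSU3_torus (z₁ z₂ : Circle) : IsQuantumSU3 q (torus B z₁ z₂) := by
  have hz : ∀ z : Circle, (z : ℂ) ≠ 0 := Circle.coe_ne_zero
  have h1 : (z₁ : ℂ) * ((z₂ : ℂ) * ((z₁ : ℂ)⁻¹ * (z₂ : ℂ)⁻¹)) = 1 := by
    field_simp [hz]
  refine ⟨?_, ?_⟩
  · rw [Unitary.mem_iff]
    constructor <;>
    · ext i j
      fin_cases i <;> fin_cases j <;>
        simp [torus, Matrix.mul_apply, Fin.sum_univ_three, Matrix.star_apply, smul_smul,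
          ← Circle.coe_inv_eq_conj, mul_comm, hz, mul_assoc, h1]
  · intro a b c
    rw [sum_E, E_smul]
    fin_cases a <;> fin_cases b <;> fin_cases c <;>
      simp [torus, inversions, smul_smul, hz, mul_comm,
        h1]
    all_goals (match_scalars; field_simp [hz])

theorem commute_torus (x : B) (z₁ z₂ : Circle) (k l : Fin 3) :
    Commute x (torus B z₁ z₂ k l) := by
  fin_cases k <;> fin_cases l <;>
    simp [torus, -Circle.coe_mul, -Circle.coe_inv]

theorem block12_det {R : Type*} [Ring R] [Algebra ℝ R] (q : ℝ) (a a' c c' : R)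
    (k1 : a * a' = 1 - q ^ 2 • (c' * c)) (k2 : a' * a = 1 - c' * c)
    (k4 : a * c' = q • (c' * a)) (k6 : c * a' = q • (a' * c)) (h3 : c * c' = c' * c)
    (u : Matrix (Fin 3) (Fin 3) R)
    (hu : u = !![a, -(q • c'), 0; c, a', 0; 0, 0, 1]) (x y z : Fin 3) :
      u x 0 * (u y 1 * u z 2) - q • (u x 0 * (u y 2 * u z 1)) - q • (u x 1 * (u y 0 * u z 2))
      + q ^ 2 • (u x 1 * (u y 2 * u z 0)) + q ^ 2 • (u x 2 * (u y 0 * u z 1))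
      - q ^ 3 • (u x 2 * (u y 1 * u z 0)) =
    (if x ≠ y ∧ x ≠ z ∧ y ≠ z then (-q) ^ inversions x y z else 0 : ℝ) • (1 : R) := by
  subst hu
  fin_cases x <;> fin_cases y <;> fin_cases z <;>
    simp [inversions, smul_smul, k1, k2, k4, k6, h3]
  all_goals module

theorem block23_det {R : Type*} [Ring R] [Algebra ℝ R] (q : ℝ) (a a' c c' : R)
    (k1 : a * a' = 1 - q ^ 2 • (c' * c)) (k2 : a' * a = 1 - c' * c)
    (k4 : a * c' = q • (c' * a)) (k6 : c * a' = q • (a' * c)) (h3 : c * c' = c' * c)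
    (u : Matrix (Fin 3) (Fin 3) R)
    (hu : u = !![1, 0, 0; 0, a, -(q • c'); 0, c, a']) (x y z : Fin 3) :
      u x 0 * (u y 1 * u z 2) - q • (u x 0 * (u y 2 * u z 1)) - q • (u x 1 * (u y 0 * u z 2))
      + q ^ 2 • (u x 1 * (u y 2 * u z 0)) + q ^ 2 • (u x 2 * (u y 0 * u z 1))
      - q ^ 3 • (u x 2 * (u y 1 * u z 0)) =
    (if x ≠ y ∧ x ≠ z ∧ y ≠ z then (-q) ^ inversions x y z else 0 : ℝ) • (1 : R) := by
  subst hu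
  fin_cases x <;> fin_cases y <;> fin_cases z <;>
    simp [inversions, smul_smul, k1, k2, k4, k6, h3]
  all_goals module

theorem IsQuantumSU2.mk_real {α γ : B} (h : IsQuantumSU2 q α γ) :
    α * star α = 1 - q ^ 2 • (star γ * γ) ∧ star α * α = 1 - star γ * γ ∧ α * γ = q • (γ * α) ∧
    α * star γ = q • (star γ * α) ∧ star γ * star α = q • (star α * star γ) ∧
      γ * star α = q • (star α * γ) := by
  obtain ⟨h1, h2, h3, h4, h5⟩ := h
  refine ⟨?_, eq_sub_of_add_eq h1, ?_, ?_, ?_, ?_⟩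
  · rw [← h3]
    refine eq_sub_of_add_eq ?_
    rw [← h2, ← Complex.coe_smul]; simp
  · simpa using h4
  · simpa using h5
  · simpa using congrArg star h4
  · simpa using congrArg star h5

theorem IsQuantumSU2.block12 {α γ : B} (h : IsQuantumSU2 q α γ) :
    IsQuantumSU3 q (block12 q α γ) := by
  obtain ⟨k1, k2, k3, k4, k5, k6⟩ := h.mk_real
  have h3 := h.h3
  refine ⟨?_, ?_⟩
  · rw [Unitary.mem_iff]
    constructor <;>
    · ext i j
      fin_cases i <;> fin_cases j <;>
        simp [QFlag.block12, Matrix.mul_apply, Fin.sum_univ_three, Matrix.star_apply, smul_smul,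
          k1, k2, k3, k4, k5, k6, h3, ← sq]
  · intro a b c
    rw [sum_E, E_smul]
    exact block12_det q α (star α) γ (star γ) k1 k2 k4 k6 h3 _
      (by simp [QFlag.block12]) a b c

theorem IsQuantumSU2.block23 {α γ : B} (h : IsQuantumSU2 q α γ) :
    IsQuantumSU3 q (block23 q α γ) := by
  obtain ⟨k1, k2, k3, k4, k5, k6⟩ := h.mk_real
  have h3 := h.h3
  refine ⟨?_, ?_⟩
  · rw [Unitary.mem_iff]
    constructor <;>
    · ext i j
      fin_cases i <;> fin_cases j <;>
        simp [QFlag.block23, Matrix.mul_apply, Fin.sum_univ_three, Matrix.star_apply, smul_smul,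
          k1, k2, k3, k4, k5, k6, h3, ← sq]
  · intro a b c
    rw [sum_E, E_smul]
    exact block23_det q α (star α) γ (star γ) k1 k2 k4 k6 h3 _
      (by simp [QFlag.block23]) a b c
end lemmas
/-- The Hilbert space `ℓ²(ℕ^k)`; for `k = 0` it is the one-dimensional space `ℂ`. -/
abbrev Hilb (k : ℕ) : Type := lp (fun _ : Fin k → ℕ => ℂ) 2

section ops
variable {k : ℕ}

/-- The operator `f ↦ (n ↦ w n * f (σ n))` on `ℓ²(ℕ^k)`, for `σ` injective and `|w| ≤ 1`. -/
def wcomp (σ : (Fin k → ℕ) → (Fin k → ℕ)) (hσ : Function.Injective σ)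
    (w : (Fin k → ℕ) → ℝ) (hw : ∀ n, |w n| ≤ 1) : Hilb k →L[ℂ] Hilb k :=
  have key : ∀ f : Hilb k, ∀ s : Finset (Fin k → ℕ),
      ∑ n ∈ s, ‖(w n : ℂ) * f (σ n)‖ ^ (2 : ℝ≥0∞).toReal ≤ ‖f‖ ^ (2 : ℝ≥0∞).toReal := by
    intro f s
    refine le_trans (Finset.sum_le_sum (g := fun n => ‖f (σ n)‖ ^ (2 : ℝ≥0∞).toReal)
      fun n _ => ?_) ?_
    · refine Real.rpow_le_rpow (norm_nonneg _) ?_ (by simp)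
      rw [norm_mul, Complex.norm_real, Real.norm_eq_abs]
      exact mul_le_of_le_one_left (norm_nonneg _) (hw n)
    · have h := lp.sum_rpow_le_norm_rpow (p := 2) (by simp) f (s.map ⟨σ, hσ⟩)
      simpa only [Finset.sum_map, Function.Embedding.coeFn_mk] using h
  LinearMap.mkContinuous
    { toFun := fun f => ⟨fun n => (w n : ℂ) * f (σ n), memℓp_gen' (key f)⟩
      map_add' := fun f g => by ext n; exact mul_add _ _ _
      map_smul' := fun c f => by ext n; simp [mul_left_comm] }
    1 (fun f => by
      rw [one_mul]
      exact lp.norm_le_of_forall_sum_le (by simp) (norm_nonneg _) (key f))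

theorem wcomp_apply (σ : (Fin k → ℕ) → (Fin k → ℕ)) (hσ : Function.Injective σ)
    (w : (Fin k → ℕ) → ℝ) (hw : ∀ n, |w n| ≤ 1) (f : Hilb k) (n : Fin k → ℕ) :
    wcomp σ hσ w hw f n = (w n : ℂ) * f (σ n) := rfl

variable (q : Set.Ioo (0 : ℝ) 1)

theorem one_sub_pow_mem (m : ℕ) : 0 ≤ 1 - (q : ℝ) ^ (2 * m) ∧ 1 - (q : ℝ) ^ (2 * m) ≤ 1 := by
  have h0 := pow_le_one₀ q.2.1.le q.2.2.le (n := 2 * m)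
  have h1 := pow_nonneg q.2.1.le (2 * m)
  constructor <;> linarith

/-- The operator lowering the `j`-th coordinate. In terms of the standard basis,
`opA q j |n⟩ = √(1 - q^(2 n_j)) |n - e_j⟩` (which is `0` if `n_j = 0`); the definition states this
in terms of coefficients. -/
def opA (j : Fin k) : Hilb k →L[ℂ] Hilb k :=
  wcomp (fun n => n + Pi.single j 1) (add_left_injective _)
    (fun n => √(1 - (q : ℝ) ^ (2 * (n j + 1)))) fun n => by
      rw [abs_of_nonneg (Real.sqrt_nonneg _)]
      exact Real.sqrt_le_one.2 (one_sub_pow_mem q _).2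

/-- The diagonal operator `opC q j |n⟩ = q^(n_j) |n⟩`. -/
def opC (j : Fin k) : Hilb k →L[ℂ] Hilb k :=
  wcomp id Function.injective_id (fun n => (q : ℝ) ^ n j) fun n => by
    rw [abs_of_nonneg (pow_nonneg q.2.1.le _)]
    exact pow_le_one₀ q.2.1.le q.2.2.le

variable {q}

theorem opA_apply (j : Fin k) (f : Hilb k) (n : Fin k → ℕ) :
    opA q j f n = (√(1 - (q : ℝ) ^ (2 * (n j + 1))) : ℂ) * f (n + Pi.single j 1) := rfl

theorem opC_apply (j : Fin k) (f : Hilb k) (n : Fin k → ℕ) :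
    opC q j f n = (((q : ℝ) ^ n j : ℝ) : ℂ) * f n := rfl

theorem star_apply_eq (T : Hilb k →L[ℂ] Hilb k) (f : Hilb k) (n : Fin k → ℕ) :
    star T f n = inner ℂ (T (lp.single 2 n 1)) f := by
  rw [ContinuousLinearMap.star_eq_adjoint, ← ContinuousLinearMap.adjoint_inner_right,
    lp.inner_single_left]
  simp

theorem star_opC (j : Fin k) : star (opC (k := k) q j) = opC q j := by
  ext f n
  rw [star_apply_eq]
  have : opC q j (lp.single 2 n 1 : Hilb k) = lp.single 2 n (((q : ℝ) ^ n j : ℝ) : ℂ) := by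
    ext m
    rw [opC_apply, lp.single_apply, lp.single_apply]
    by_cases h : m = n
    · subst h; simp
    · simp [h]
  rw [this, lp.inner_single_left, opC_apply]
  simp [mul_comm]

theorem star_opA_apply (j : Fin k) (f : Hilb k) (n : Fin k → ℕ) :
    star (opA q j) f n = (√(1 - (q : ℝ) ^ (2 * n j)) : ℂ) * f (n - Pi.single j 1) := by
  rw [star_apply_eq]
  have : opA q j (lp.single 2 n 1 : Hilb k) =
      lp.single 2 (n - Pi.single j 1) ((√(1 - (q : ℝ) ^ (2 * n j)) : ℝ) : ℂ) := by
    ext m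
    rw [opA_apply, lp.single_apply, lp.single_apply]
    by_cases h : m + Pi.single j 1 = n
    · subst h; simp
    · by_cases h' : m = n - Pi.single j 1
      · have hn : n j = 0 := by
          by_contra hn
          refine h ?_
          subst h'
          ext i
          by_cases hi : i = j
          · subst hi; simp; omega
          · simp [hi]
        rw [Pi.single_eq_of_ne h, h', Pi.single_eq_same, hn]
        simp
      · simp [h, h']
  rw [this, lp.inner_single_left]
  simp [mul_comm]

theorem sub_add_single {j : Fin k} {n : Fin k → ℕ} (h : n j ≠ 0) :
    n - Pi.single j 1 + Pi.single j 1 = n := by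
  ext i
  by_cases hi : i = j
  · subst hi; simp; omega
  · simp [hi]

theorem sub_add_single_comm {i j : Fin k} (h : i ≠ j) (n : Fin k → ℕ) :
    n - Pi.single j 1 + Pi.single i 1 = n + Pi.single i 1 - Pi.single j 1 := by
  ext l
  by_cases hi : l = j
  · subst hi; simp [h.symm]
  · simp [hi]

theorem opA_opC_commute {i j : Fin k} (h : i ≠ j) : Commute (opA q i) (opC q j) := by
  refine ContinuousLinearMap.ext fun f => ?_
  ext n
  simp only [mul_apply_eq_comp, opA_apply, opC_apply]
  simp [h.symm, mul_left_comm]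

theorem opC_opC_commute (i j : Fin k) : Commute (opC (k := k) q i) (opC q j) := by
  refine ContinuousLinearMap.ext fun f => ?_
  ext n
  simp only [mul_apply_eq_comp, opC_apply]
  simp [mul_left_comm]

theorem opA_opA_commute {i j : Fin k} (h : i ≠ j) : Commute (opA (k := k) q i) (opA q j) := by
  refine ContinuousLinearMap.ext fun f => ?_
  ext n
  simp only [mul_apply_eq_comp, opA_apply]
  simp [h, h.symm, mul_left_comm, add_right_comm]

theorem opA_star_opA_commute {i j : Fin k} (h : i ≠ j) :
    Commute (opA (k := k) q i) (star (opA q j)) := by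
  refine ContinuousLinearMap.ext fun f => ?_
  ext n
  simp only [mul_apply_eq_comp, opA_apply, star_opA_apply, sub_add_single_comm h]
  simp [h, h.symm, mul_left_comm]

theorem one_sub_sqrt_sq (m : ℕ) :
    ((√(1 - (q : ℝ) ^ (2 * m)) : ℝ) : ℂ) * ((√(1 - (q : ℝ) ^ (2 * m)) : ℝ) : ℂ) =
      1 - (q : ℂ) ^ (2 * m) := by
  rw [← Complex.ofReal_mul, Real.mul_self_sqrt (one_sub_pow_mem q m).1]
  simp

theorem isQuantumSU2_op (j : Fin k) (ν : Circle) :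
    IsQuantumSU2 (q : ℝ) (opA q j) ((ν : ℂ) • opC q j) := by
  have hν : (ν : ℂ) * star (ν : ℂ) = 1 := by
    rw [Complex.star_def, Complex.mul_conj, Circle.normSq_coe, Complex.ofReal_one]
  have hs : star ((ν : ℂ) • opC q j) = star (ν : ℂ) • opC (k := k) q j := by
    rw [star_smul, star_opC]
  have hAC : opA q j * opC q j = (q : ℂ) • (opC (k := k) q j * opA q j) := by
    refine ContinuousLinearMap.ext fun f => ?_
    ext n
    simp only [mul_apply_eq_comp, opA_apply, opC_apply, smul_apply,
      lp.coeFn_smul, Pi.smul_apply, smul_eq_mul]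
    simp
    ring
  refine ⟨?_, ?_, ?_, ?_, ?_⟩
  · rw [hs, smul_mul_smul_comm, mul_comm (star _), hν, one_smul]
    refine ContinuousLinearMap.ext fun f => ?_
    ext n
    simp only [mul_apply_eq_comp, add_apply, lp.coeFn_add,
      Pi.add_apply, opA_apply, opC_apply, star_opA_apply, one_apply_eq_self]
    by_cases h : n j = 0
    · simp [h]
    · have h2 : (n - Pi.single j 1 : Fin k → ℕ) j + 1 = n j := by simp; omega
      rw [h2, sub_add_single h, ← mul_assoc, one_sub_sqrt_sq]
      push_cast
      ring
  · rw [hs, smul_mul_smul_comm, hν, one_smul]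
    refine ContinuousLinearMap.ext fun f => ?_
    ext n
    simp only [mul_apply_eq_comp, add_apply, lp.coeFn_add,
      Pi.add_apply, opA_apply, opC_apply, star_opA_apply, one_apply_eq_self,
      smul_apply, lp.coeFn_smul, Pi.smul_apply, smul_eq_mul]
    have h2 : n j + (Pi.single j 1 : Fin k → ℕ) j = n j + 1 := by simp
    erw [h2]
    rw [add_tsub_cancel_right, ← mul_assoc, one_sub_sqrt_sq]
    push_cast
    ring
  · rw [hs, smul_mul_smul_comm, smul_mul_smul_comm, mul_comm (star _)]
  · rw [mul_smul_comm, hAC, smul_mul_assoc, smul_comm]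
  · rw [hs, mul_smul_comm, hAC, smul_mul_assoc, smul_comm]
end ops

section families

/-- The labels `0, 11, 12, 21, 22, 3` of the six families of irreducible representations. -/
inductive Family : Type
  | zero | oneOne | oneTwo | twoOne | twoTwo | three

/-- The family labelled `s` acts on `ℓ²(ℕ^(dim s))`. -/
def Family.dim : Family → ℕ
  | .zero => 0
  | .oneOne => 1
  | .oneTwo => 1
  | .twoOne => 2
  | .twoTwo => 2
  | .three => 3

/-- The quantum `SU(2)` representation `α ↦ opA q j`, `γ ↦ ν opC q j` in rows and columns `1, 2`. -/
abbrev T12 (q : Set.Ioo (0 : ℝ) 1) {k : ℕ} (j : Fin k) (ν : Circle) :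
    Matrix (Fin 3) (Fin 3) (Hilb k →L[ℂ] Hilb k) :=
  block12 q (opA q j) ((ν : ℂ) • opC q j)

/-- The quantum `SU(2)` representation `α ↦ opA q j`, `γ ↦ ν opC q j` in rows and columns `2, 3`. -/
abbrev T23 (q : Set.Ioo (0 : ℝ) 1) {k : ℕ} (j : Fin k) (ν : Circle) :
    Matrix (Fin 3) (Fin 3) (Hilb k →L[ℂ] Hilb k) :=
  block23 q (opA q j) ((ν : ℂ) • opC q j)

/-- The operators `π_s^{φ,ψ}(u_ij)`, arranged in a matrix. The phases are normalized so that
* `0`: `u = diag(φ, ψ, (φψ)⁻¹)`;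
* `11`: `u₁₂ = φ q^(N+1)`, `u₂₁ = ψ q^N`, and `u₁₃ = u₃₁ = u₂₃ = u₃₂ = 0`;
* `12`: `u₂₃ = ψ q^(N+1)`, `u₃₂ = (φψ)⁻¹ q^N`, and `u₁₂ = u₂₁ = u₁₃ = u₃₁ = 0`;
* `21`: `u₂₁ = φ q^N`, `u₁₃ = ψ q^(N+M+2)`, and `u₃₁ = 0`;
* `22`: `u₃₁ = φ q^(N+M)`, `u₁₂ = ψ q^(N+1)`, and `u₁₃ = 0`;
* `3`: `u₃₁ = φ q^(N+L)`, `u₁₃ = ψ q^(N+M+2)`;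

here the listed entries are diagonal operators in the basis `|N⟩`, `|N, M⟩`, `|N, M, L⟩`. -/
def piMatrix (q : Set.Ioo (0 : ℝ) 1) (φ ψ : Circle) :
    (s : Family) → Matrix (Fin 3) (Fin 3) (Hilb s.dim →L[ℂ] Hilb s.dim)
  | .zero => torus _ φ ψ
  | .oneOne => T12 q (k := 1) 0 ψ * torus _ 1 (-(φ * ψ))
  | .oneTwo => T23 q (k := 1) 0 (φ * ψ)⁻¹ * torus _ (-φ) 1
  | .twoOne => T12 q (k := 2) 0 φ * T23 q (k := 2) 1 (φ * ψ)⁻¹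
  | .twoTwo => T23 q (k := 2) 1 (-(φ * ψ)) * T12 q (k := 2) 0 (-ψ⁻¹)
  | .three => T23 q (k := 3) 2 φ * T12 q (k := 3) 0 1 * T23 q (k := 3) 1 ψ⁻¹

variable {q : Set.Ioo (0 : ℝ) 1} {k : ℕ}

theorem T12_rel (j : Fin k) (ν : Circle) : IsQuantumSU3 (q : ℝ) (T12 q j ν) :=
  (isQuantumSU2_op j ν).block12

theorem T23_rel (j : Fin k) (ν : Circle) : IsQuantumSU3 (q : ℝ) (T23 q j ν) :=
  (isQuantumSU2_op j ν).block23

theorem entries_commute {i j : Fin k} (h : i ≠ j) (ν κ : Circle)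
    (x y : Hilb k →L[ℂ] Hilb k)
    (hx : x ∈ ({0, 1, opA q i, star (opA q i), (ν : ℂ) • opC q i,
      -(((q : ℝ) : ℂ) • star ((ν : ℂ) • opC q i))} : Set (Hilb k →L[ℂ] Hilb k)))
    (hy : y ∈ ({0, 1, opA q j, star (opA q j), (κ : ℂ) • opC q j,
      -(((q : ℝ) : ℂ) • star ((κ : ℂ) • opC q j))} : Set (Hilb k →L[ℂ] Hilb k))) :
    Commute x y := by
  have hs (μ : Circle) (l : Fin k) :
      star ((μ : ℂ) • opC q l) = star (μ : ℂ) • opC (k := k) q l := by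
    rw [star_smul, star_opC]
  have a2 := opA_opC_commute (q := q) h
  have a3 := (opA_opC_commute (q := q) h.symm).symm
  have a4 := opC_opC_commute (q := q) i j
  have a9 : Commute (opC q i) (star (opA q j)) := by
    simpa only [star_opC] using a3.star_star
  refine commute_of_entries (opA_opA_commute h) (a2.smul_right _) (a3.smul_left _)
    ((a4.smul_left _).smul_right _) (opA_star_opA_commute h) ?_ (a9.smul_left _) ?_ hx hy
  · rw [hs]; exact a2.smul_right _
  · rw [hs]; exact (a4.smul_left _).smul_right _

theorem piMatrix_rel (φ ψ : Circle) : (s : Family) → IsQuantumSU3 (q : ℝ) (piMatrix q φ ψ s)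
  | .zero => isQuantumSU3_torus _ _
  | .oneOne => (T12_rel _ _).mul (isQuantumSU3_torus _ _) fun _ _ => commute_torus _ _ _
  | .oneTwo => (T23_rel _ _).mul (isQuantumSU3_torus _ _) fun _ _ => commute_torus _ _ _
  | .twoOne => (T12_rel _ _).mul (T23_rel _ _) fun _ _ _ _ =>
      entries_commute (by decide) _ _ _ _ (block12_mem _ _ _ _) (block23_mem _ _ _ _)
  | .twoTwo => (T23_rel _ _).mul (T12_rel _ _) fun _ _ _ _ =>
      entries_commute (by decide) _ _ _ _ (block23_mem _ _ _ _) (block12_mem _ _ _ _)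
  | .three => ((T23_rel _ _).mul (T12_rel _ _) fun _ _ _ _ =>
      entries_commute (by decide) _ _ _ _ (block23_mem _ _ _ _) (block12_mem _ _ _ _)).mul
        (T23_rel _ _) fun a b c d => by
          rw [Matrix.mul_apply]
          refine Commute.sum_left _ _ _ fun e _ => Commute.mul_left ?_ ?_
          · exact entries_commute (by decide) _ _ _ _ (block23_mem _ _ _ _) (block23_mem _ _ _ _)
          · exact entries_commute (by decide) _ _ _ _ (block12_mem _ _ _ _) (block23_mem _ _ _ _)
end families

section universal

/-- A realization of the relations of quantum `SU(3)` in a nonzero unital C*-algebra. -/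
structure Realization (q : ℝ) : Type 1 where
  carrier : Type
  [cstar : CStarAlgebra carrier]
  [nontriv : Nontrivial carrier]
  u : Matrix (Fin 3) (Fin 3) carrier
  rel : IsQuantumSU3 q u

attribute [instance] Realization.cstar Realization.nontriv

variable (q : ℝ)

/-- The C*-algebra of bounded families in the product of all realizations. -/
abbrev Ambient : Type 1 := lp (fun r : Realization q => r.carrier) ∞

instance : CStarAlgebra (Ambient q) where

/-- The family of all the `(i, j)` entries. -/
def ambientGen (i j : Fin 3) : Ambient q :=
  ⟨fun r => r.u i j, memℓp_infty ⟨1, by rintro _ ⟨r, rfl⟩; exact r.rel.norm_le i j⟩⟩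

/-- The C*-algebra `C(SU_q(3))`: the universal unital C*-algebra generated by the entries `u_ij` of a
matrix satisfying the relations. It is the closed *-subalgebra generated by the `u_ij` in the product
of all realizations; its universal property is `gen_rel`, `lift`, `lift_gen`, `hom_ext`. -/
def CSU3 : StarSubalgebra ℂ (Ambient q) :=
  (StarAlgebra.adjoin ℂ (Set.range fun p : Fin 3 × Fin 3 => ambientGen q p.1 p.2)).topologicalClosure

instance : IsClosed (CSU3 q : Set (Ambient q)) := StarSubalgebra.isClosed_topologicalClosure _

variable {q}

/-- The generators `u_ij` of `C(SU_q(3))`. -/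
def gen (i j : Fin 3) : CSU3 q :=
  ⟨ambientGen q i j, StarSubalgebra.le_topologicalClosure _
    (StarAlgebra.subset_adjoin ℂ _ ⟨(i, j), rfl⟩)⟩

/-- Evaluation at a realization. -/
def Ambient.eval (r : Realization q) : Ambient q →⋆ₐ[ℂ] r.carrier where
  toFun x := x r
  map_one' := rfl
  map_mul' _ _ := rfl
  map_zero' := rfl
  map_add' _ _ := rfl
  commutes' _ := rfl
  map_star' _ := rfl

/-- The *-homomorphism out of `C(SU_q(3))` determined by a matrix satisfying the relations. -/
def lift {B : Type} [CStarAlgebra B] [Nontrivial B] {v : Matrix (Fin 3) (Fin 3) B}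
    (hv : IsQuantumSU3 q v) : CSU3 q →⋆ₐ[ℂ] B :=
  (Ambient.eval ⟨B, v, hv⟩).comp (CSU3 q).subtype

theorem lift_gen {B : Type} [CStarAlgebra B] [Nontrivial B] {v : Matrix (Fin 3) (Fin 3) B}
    (hv : IsQuantumSU3 q v) (i j : Fin 3) : lift hv (gen i j) = v i j := rfl

theorem lift_ext {x y : CSU3 q} (h : ∀ r : Realization q, lift r.rel x = lift r.rel y) :
    x = y :=
  Subtype.ext (lp.ext (funext h))

/-- The generators satisfy the relations. -/
theorem gen_rel : IsQuantumSU3 q (Matrix.of (gen (q := q))) := by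
  have hl : ∀ (r : Realization q) (i j : Fin 3), lift r.rel (gen i j) = r.u i j :=
    fun _ _ _ => rfl
  refine ⟨?_, fun a b c => lift_ext fun r => ?_⟩
  · rw [Unitary.mem_iff]
    constructor <;> refine Matrix.ext fun i j => lift_ext fun r => ?_
    · have h := congrFun (congrFun (Unitary.mem_iff.1 r.rel.isUnitary).1 i) j
      simpa only [Matrix.mul_apply, Matrix.star_apply, Matrix.of_apply, map_sum, map_mul,
        map_star, hl, Matrix.one_apply, apply_ite (lift r.rel), map_one, map_zero] using h
    · have h := congrFun (congrFun (Unitary.mem_iff.1 r.rel.isUnitary).2 i) j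
      simpa only [Matrix.mul_apply, Matrix.star_apply, Matrix.of_apply, map_sum, map_mul,
        map_star, hl, Matrix.one_apply, apply_ite (lift r.rel), map_one, map_zero] using h
  · simpa only [Matrix.of_apply, map_sum, map_smul, map_mul, map_one, hl] using
      r.rel.twistedDet a b c

open scoped CStarAlgebra in
/-- A *-homomorphism out of `C(SU_q(3))` is determined by its values on the generators. -/
theorem hom_ext {B : Type*} [CStarAlgebra B] {f g : CSU3 q →⋆ₐ[ℂ] B}
    (h : ∀ i j, f (gen i j) = g (gen i j)) : f = g := by
  refine StarAlgHom.ext_topologicalClosure (map_continuous f) (map_continuous g) ?_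
  refine StarAlgHom.ext_adjoin ?_
  rintro ⟨_, hx⟩ ⟨p, rfl⟩
  exact h p.1 p.2

/-- The realization with matrix `(z_j u_ij)`, where `z₃ = (z₁ z₂)⁻¹`. -/
def Realization.twist (r : Realization q) (z : Circle × Circle) : Realization q :=
  ⟨r.carrier, r.u * torus r.carrier z.1 z.2,
    r.rel.mul (isQuantumSU3_torus _ _) fun _ _ => commute_torus _ _ _⟩

/-- The *-endomorphism of the product induced by `Realization.twist`. -/
def Ambient.twist (z : Circle × Circle) : Ambient q →⋆ₐ[ℂ] Ambient q where
  toFun x := ⟨fun r => x (r.twist z), memℓp_infty ⟨‖x‖, by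
    rintro _ ⟨r, rfl⟩; exact lp.norm_apply_le_norm (by simp) x (r.twist z)⟩⟩
  map_one' := rfl
  map_mul' _ _ := rfl
  map_zero' := rfl
  map_add' _ _ := rfl
  commutes' _ := rfl
  map_star' _ := rfl

/-- The diagonal entries `z₁, z₂, (z₁ z₂)⁻¹`. -/
def torusCoord (z : Circle × Circle) : Fin 3 → Circle := ![z.1, z.2, (z.1 * z.2)⁻¹]

theorem Ambient.twist_gen (z : Circle × Circle) (i j : Fin 3) :
    Ambient.twist z (ambientGen q i j) = (torusCoord z j : ℂ) • ambientGen q i j := by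
  refine lp.ext (funext fun r => ?_)
  have : (r.u * torus r.carrier z.1 z.2) i j = (torusCoord z j : ℂ) • r.u i j := by
    rw [torus, Matrix.mul_diagonal]
    fin_cases j <;> simp [torusCoord, -Circle.coe_mul, -Circle.coe_inv]
  exact this

open scoped CStarAlgebra in
theorem Ambient.twist_mem (z : Circle × Circle) (x : CSU3 q) :
    Ambient.twist z (x : Ambient q) ∈ CSU3 q := by
  have hc : Continuous (Ambient.twist (q := q) z) := map_continuous _
  have h : CSU3 q ≤ (CSU3 q).comap (Ambient.twist z) := by
    refine StarSubalgebra.topologicalClosure_minimal ?_ ?_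
    · rw [StarAlgebra.adjoin_le_iff]
      rintro _ ⟨p, rfl⟩
      show Ambient.twist z (ambientGen q p.1 p.2) ∈ CSU3 q
      rw [Ambient.twist_gen]
      exact (CSU3 q).smul_mem (gen p.1 p.2).2 _
    · exact (StarSubalgebra.isClosed_topologicalClosure _).preimage hc
  exact h x.2

/-- The *-endomorphism `μ_z` with `μ_z(u_ij) = z_j u_ij`, where `z₃ = (z₁ z₂)⁻¹` (see `gaugeHom_gen`). -/
def gaugeHom (z : Circle × Circle) : CSU3 q →⋆ₐ[ℂ] CSU3 q :=
  ((Ambient.twist z).comp (CSU3 q).subtype).codRestrict (CSU3 q) (Ambient.twist_mem z)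

theorem gaugeHom_gen (z : Circle × Circle) (i j : Fin 3) :
    gaugeHom z (gen (q := q) i j) = (torusCoord z j : ℂ) • gen i j :=
  Subtype.ext (Ambient.twist_gen z i j)

theorem gaugeHom_comp (z w : Circle × Circle) :
    (gaugeHom (q := q) z).comp (gaugeHom w) = gaugeHom (z * w) := by
  refine hom_ext fun i j => ?_
  simp only [StarAlgHom.comp_apply, gaugeHom_gen, map_smul, smul_smul]
  congr 1
  fin_cases j <;> simp [torusCoord] <;> ring

theorem gaugeHom_one : gaugeHom (q := q) 1 = StarAlgHom.id ℂ (CSU3 q) := by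
  refine hom_ext fun i j => ?_
  rw [gaugeHom_gen]
  fin_cases j <;> simp [torusCoord]

/-- The gauge action `μ : 𝕋² → Aut(C(SU_q(3)))`. -/
def gauge : Circle × Circle →* (CSU3 q ≃⋆ₐ[ℂ] CSU3 q) where
  toFun z := StarAlgEquiv.ofStarAlgHom (gaugeHom z) (gaugeHom z⁻¹)
    (by rw [gaugeHom_comp, inv_mul_cancel, gaugeHom_one])
    (by rw [gaugeHom_comp, mul_inv_cancel, gaugeHom_one])
  map_one' := StarAlgEquiv.ext fun x => congrArg (fun f => f x) gaugeHom_one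
  map_mul' z w := StarAlgEquiv.ext fun x => congrArg (fun f => f x) (gaugeHom_comp z w).symm

/-- The C*-algebra `C(SU_q(3)/𝕋²)`: the fixed point algebra of the gauge action. -/
def CFlag (q : ℝ) : StarSubalgebra ℂ (CSU3 q) where
  carrier := {a | ∀ z, gauge z a = a}
  mul_mem' ha hb z := by rw [map_mul, ha z, hb z]
  add_mem' ha hb z := by rw [map_add, ha z, hb z]
  algebraMap_mem' c z := AlgHomClass.commutes (gauge z) c
  star_mem' ha z := by rw [map_star, ha z]

end universal

section reps
variable (q : Set.Ioo (0 : ℝ) 1)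

instance (k : ℕ) : Nontrivial (Hilb k) :=
  ⟨⟨lp.single 2 0 1, 0, fun h => by
    have := congrArg (fun f : Hilb k => f 0) h
    simp at this⟩⟩

/-- The representation `π_s^{φ,ψ}` of `C(SU_q(3))` on `ℓ²(ℕ^(dim s))`. -/
def piRep (s : Family) (φ ψ : Circle) : CSU3 (q : ℝ) →⋆ₐ[ℂ] (Hilb s.dim →L[ℂ] Hilb s.dim) :=
  lift (piMatrix_rel (q := q) φ ψ s)

/-- The representation `ρ_s^{φ,ψ}`: the restriction of `π_s^{φ,ψ}` to `C(SU_q(3)/𝕋²)`. -/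
def rhoRep (s : Family) (φ ψ : Circle) : CFlag (q : ℝ) →⋆ₐ[ℂ] (Hilb s.dim →L[ℂ] Hilb s.dim) :=
  (piRep q s φ ψ).comp (CFlag (q : ℝ)).subtype

end reps

/-- Unitary equivalence of two representations by bounded operators. -/
def UnitarilyEquivalent {A : Type*} [Semiring A] [Algebra ℂ A] [Star A]
    {H₁ H₂ : Type*} [NormedAddCommGroup H₁] [InnerProductSpace ℂ H₁] [CompleteSpace H₁]
    [NormedAddCommGroup H₂] [InnerProductSpace ℂ H₂] [CompleteSpace H₂]
    (π₁ : A →⋆ₐ[ℂ] (H₁ →L[ℂ] H₁)) (π₂ : A →⋆ₐ[ℂ] (H₂ →L[ℂ] H₂)) : Prop :=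
  ∃ U : H₁ ≃ₗᵢ[ℂ] H₂, ∀ (a : A) (x : H₁), U (π₁ a x) = π₂ a (U x)

end QFlag

end

namespace QFlag

/-! Two mechanisms absorb the phases. First, rescaling the columns of the fundamental matrix by a
torus element `(z₁, z₂)` is the gauge automorphism, which is invisible on the fixed point algebra.
Second, conjugation by the diagonal unitary `|n⟩ ↦ ∏ (l j)^(-n j) |n⟩` multiplies each `a_j` by `l
j` and fixes each `c_j`. So it suffices to find `l` and `(z₁, z₂)` for which the conjugated matrix
of `π^{φ,ψ}` equals that of `π^{1,1}` times `D(z₁, z₂)`; this reduction is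
`unitarilyEquivalent_of_map_piMatrix`.

To find them, sweep a torus element from left to right through the product of `SU_q(2)` blocks. By
`Rescales.torus_mul_T12` and `Rescales.torus_mul_T23`, `D` times a block with phase `w` and `a_j`
rescaled by `l j` equals the block with any prescribed phase `w'` times a new torus element, for
exactly the right value of `l j`. Each product uses an index `j` at most once, so these values can
be chosen independently, and the torus element left at the right end gives `(z₁, z₂)`. -/

/-! ### Diagonal unitaries and their conjugation action on `a_j`, `c_j` -/

/-- The unitary operator of multiplication by a function with values in the circle. -/
noncomputable def phaseMul {k : ℕ} (χ : (Fin k → ℕ) → Circle) : Hilb k ≃ₗᵢ[ℂ] Hilb k where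
  toFun f := ⟨fun n => (χ n : ℂ) * f n, (lp.memℓp f).mono' fun n => by
    rw [norm_mul, Circle.norm_coe, one_mul]⟩
  invFun f := ⟨fun n => ((χ n)⁻¹ : Circle) * f n, (lp.memℓp f).mono' fun n => by
    rw [norm_mul, Circle.norm_coe, one_mul]⟩
  map_add' f g := by ext n; exact mul_add _ _ _
  map_smul' c f := by ext n; simp [mul_left_comm]
  left_inv f := by ext n; simp
  right_inv f := by ext n; simp
  norm_map' f := by
    simp only [lp.norm_eq_tsum_rpow (p := 2) (by simp)]
    refine congrArg (· ^ _) (tsum_congr fun n => congrArg (· ^ _) ?_)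
    exact (norm_mul (χ n : ℂ) (f n)).trans (by rw [Circle.norm_coe, one_mul])

theorem phaseMul_apply {k : ℕ} (χ : (Fin k → ℕ) → Circle) (f : Hilb k) (n : Fin k → ℕ) :
    phaseMul χ f n = (χ n : ℂ) * f n := rfl

theorem phaseMul_symm_apply {k : ℕ} (χ : (Fin k → ℕ) → Circle) (f : Hilb k) (n : Fin k → ℕ) :
    (phaseMul χ).symm f n = ((χ n)⁻¹ : Circle) * f n := rfl

/-- The unitary `|n⟩ ↦ ∏ j, (l j)^(-n j) |n⟩`. -/
noncomputable def torusUnitary {k : ℕ} (l : Fin k → Circle) : Hilb k ≃ₗᵢ[ℂ] Hilb k :=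
  phaseMul fun n => ∏ i, (l i)⁻¹ ^ n i

/-- Conjugation by `torusUnitary l`. -/
noncomputable def torusConj {k : ℕ} (l : Fin k → Circle) :
    (Hilb k →L[ℂ] Hilb k) →⋆ₐ[ℂ] (Hilb k →L[ℂ] Hilb k) :=
  ((torusUnitary l).conjStarAlgEquiv : (Hilb k →L[ℂ] Hilb k) →⋆ₐ[ℂ] (Hilb k →L[ℂ] Hilb k))

theorem torusConj_apply_apply {k : ℕ} (l : Fin k → Circle) (T : Hilb k →L[ℂ] Hilb k)
    (f : Hilb k) : torusConj l T f = torusUnitary l (T ((torusUnitary l).symm f)) := rfl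

variable {q : Set.Ioo (0 : ℝ) 1} {k : ℕ}

/-- `a_j` takes `|n⟩` to a multiple of `|n - e_j⟩`, so conjugation contributes only the quotient of
the phases at neighbouring lattice points, which is independent of `n` because the phase is a
character in `n`. -/
theorem torusConj_opA (l : Fin k → Circle) (j : Fin k) :
    torusConj l (opA q j) = (l j : ℂ) • opA q j := by
  refine ContinuousLinearMap.ext fun f => ?_
  ext n
  -- Ratio of the phases at `n` and `n + e_j`: all factors cancel except one `(l j)⁻¹` in the
  -- denominator. This is why the unitary carries inverse powers.
  have h : (∏ i, (l i)⁻¹ ^ n i) * (∏ i, (l i)⁻¹ ^ (n + Pi.single j 1 : Fin k → ℕ) i)⁻¹ = l j := by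
    simp only [Pi.add_apply, pow_add, Finset.prod_mul_distrib]
    rw [Finset.prod_eq_single (f := fun i => (l i)⁻¹ ^ (Pi.single j 1 : Fin k → ℕ) i) j]
    · simp [-Finset.prod_inv_distrib]
    · intro i _ hi; simp [hi]
    · simp
  rw [torusConj_apply_apply]
  simp only [torusUnitary, phaseMul_apply, phaseMul_symm_apply, opA_apply, smul_apply,
    lp.coeFn_smul, Pi.smul_apply, smul_eq_mul]
  rw [← h, Circle.coe_mul]
  ring

theorem torusConj_opC (l : Fin k → Circle) (j : Fin k) :
    torusConj l (opC q j) = opC q j := by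
  refine ContinuousLinearMap.ext fun f => ?_
  ext n
  rw [torusConj_apply_apply]
  simp only [torusUnitary, phaseMul_apply, phaseMul_symm_apply, opC_apply]
  rw [mul_left_comm, Circle.coe_inv, mul_inv_cancel_left₀ (Circle.coe_ne_zero _)]

/-! ### Moving torus elements through the `SU_q(2)` blocks -/

theorem torus_mul_torus {B : Type*} [CStarAlgebra B] (z w z' w' : Circle) :
    torus B z w * torus B z' w' = torus B (z * z') (w * w') := by
  rw [torus, torus, torus, Matrix.diagonal_mul_diagonal]
  congr 1
  ext i
  fin_cases i <;> simp [smul_smul] <;> ring_nf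

theorem map_torus {B : Type*} [CStarAlgebra B] (F : B →⋆ₐ[ℂ] B) (z w : Circle) :
    (torus B z w).map F = torus B z w := by
  rw [torus, Matrix.diagonal_map (map_zero F)]
  congr 1
  ext i
  fin_cases i <;> simp [-Circle.coe_inv, -Circle.coe_mul]

/-- The *-homomorphism `F` rescales each lowering operator `opA q j` by the phase `l j` and fixes
each `opC q j`. -/
structure Rescales (q : Set.Ioo (0 : ℝ) 1)
    (F : (Hilb k →L[ℂ] Hilb k) →⋆ₐ[ℂ] (Hilb k →L[ℂ] Hilb k)) (l : Fin k → Circle) : Prop where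
  map_opA (j : Fin k) : F (opA q j) = (l j : ℂ) • opA q j
  map_opC (j : Fin k) : F (opC q j) = opC q j

section
variable {F : (Hilb k →L[ℂ] Hilb k) →⋆ₐ[ℂ] (Hilb k →L[ℂ] Hilb k)} {l : Fin k → Circle}

/-- Comparing the `c_j` entries forces the new first two diagonal entries to be `z₂ w w'⁻¹` and `z₁
w⁻¹ w'`. The `a_j` and `a_j*` entries then agree precisely under the single condition `hl`. The
product of the two entries is still `z₁ z₂`, so the third diagonal entry is unchanged. -/
theorem Rescales.torus_mul_T12 (hF : Rescales q F l) {j : Fin k} (z₁ z₂ w w' : Circle)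
    (hl : l j = z₂ * w * w'⁻¹ * z₁⁻¹) :
    torus _ z₁ z₂ * (T12 q j w).map F =
      T12 q j w' * torus _ (z₂ * w * w'⁻¹) (z₁ * w⁻¹ * w') := by
  have h (z : Circle) : (starRingEnd ℂ) z = ((z⁻¹ : Circle) : ℂ) := (Circle.coe_inv_eq_conj z).symm
  have hz (z : Circle) : (z : ℂ) ≠ 0 := Circle.coe_ne_zero z
  ext1 a b
  rw [torus, torus, Matrix.diagonal_mul, Matrix.mul_diagonal, Matrix.map_apply]
  fin_cases a <;> fin_cases b <;>
    simp [block12, star_smul, star_opC, map_star, hF.map_opA, hF.map_opC, hl, smul_smul, h]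
  all_goals
    field_simp [hz]

/-- The same comparison in the lower block, with `z₂` and `z₃ = (z₁ z₂)⁻¹` in the roles of `z₁` and
`z₂`; now the first diagonal entry is the one left alone. -/
theorem Rescales.torus_mul_T23 (hF : Rescales q F l) {j : Fin k} (z₁ z₂ w w' : Circle)
    (hl : l j = (z₁ * z₂)⁻¹ * w * w'⁻¹ * z₂⁻¹) :
    torus _ z₁ z₂ * (T23 q j w).map F =
      T23 q j w' * torus _ z₁ ((z₁ * z₂)⁻¹ * w * w'⁻¹) := by
  have h (z : Circle) : (starRingEnd ℂ) z = ((z⁻¹ : Circle) : ℂ) := (Circle.coe_inv_eq_conj z).symm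
  have hz (z : Circle) : (z : ℂ) ≠ 0 := Circle.coe_ne_zero z
  ext1 a b
  rw [torus, torus, Matrix.diagonal_mul, Matrix.mul_diagonal, Matrix.map_apply]
  fin_cases a <;> fin_cases b <;>
    simp [block23, star_smul, star_opC, map_star, hF.map_opA, hF.map_opC, hl, smul_smul, h]
  all_goals
    field_simp [hz]

theorem torus_one_one {B : Type*} [CStarAlgebra B] : torus B 1 1 = 1 := by
  rw [torus, Matrix.diagonal_eq_one]
  ext i
  fin_cases i <;> simp

/-- Starts the sweep: the trivial torus element enters from the left. -/
theorem Rescales.T12_map (hF : Rescales q F l) {j : Fin k} (w w' : Circle)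
    (hl : l j = w * w'⁻¹) :
    (T12 q j w).map F = T12 q j w' * torus _ (w * w'⁻¹) (w⁻¹ * w') := by
  simpa [torus_one_one] using hF.torus_mul_T12 1 1 w w' (by simpa using hl)

theorem Rescales.T23_map (hF : Rescales q F l) {j : Fin k} (w w' : Circle)
    (hl : l j = w * w'⁻¹) :
    (T23 q j w).map F = T23 q j w' * torus _ 1 (w * w'⁻¹) := by
  simpa [torus_one_one] using hF.torus_mul_T23 1 1 w w' (by simpa using hl)

end

/-! ### Reduction to a matrix identity -/

theorem rescales_torusConj (l : Fin k → Circle) : Rescales q (torusConj l) l :=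
  ⟨torusConj_opA l, torusConj_opC l⟩

theorem gaugeHom_mem_CFlag (z : Circle × Circle) (a : CFlag (q : ℝ)) :
    gaugeHom z (a : CSU3 (q : ℝ)) = a := a.2 z

/-- If `torusConj l` turns the matrix of `π_s^{φ,ψ}` into the matrix of `π_s^{1,1}` with its
columns rescaled by a torus element, then `torusUnitary l` intertwines the restrictions of these
representations to the gauge invariant elements. -/
theorem unitarilyEquivalent_of_map_piMatrix (s : Family) (φ ψ z₁ z₂ : Circle)
    (l : Fin s.dim → Circle)
    (h : (piMatrix q φ ψ s).map (torusConj l) = piMatrix q 1 1 s * torus _ z₁ z₂) :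
    UnitarilyEquivalent (rhoRep q s φ ψ) (rhoRep q s 1 1) := by
  -- On generators this is the hypothesis `h` read entry by entry; the universal property extends it
  -- to all of `C(SU_q(3))`.
  have key : (torusConj l).comp (piRep q s φ ψ) =
      (piRep q s 1 1).comp (gaugeHom (z₁, z₂)) := by
    refine hom_ext fun i j => ?_
    have hij := congrFun (congrFun h i) j
    rw [torus, Matrix.mul_diagonal, Matrix.map_apply] at hij
    rw [StarAlgHom.comp_apply, StarAlgHom.comp_apply, gaugeHom_gen, map_smul, piRep, piRep,
      lift_gen, lift_gen]
    refine hij.trans ?_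
    fin_cases j <;> simp [torusCoord, -Circle.coe_mul, -Circle.coe_inv]
  refine ⟨torusUnitary l, fun a x => ?_⟩
  -- Evaluating at the image of `x` cancels the inverse unitary inside the conjugation, and
  -- invariance of `a` removes the gauge automorphism.
  have ha := DFunLike.congr_fun (DFunLike.congr_fun key (a : CSU3 (q : ℝ))) (torusUnitary l x)
  rw [StarAlgHom.comp_apply, StarAlgHom.comp_apply, gaugeHom_mem_CFlag, torusConj_apply_apply,
    LinearIsometryEquiv.symm_apply_apply] at ha
  exact ha

end QFlag

/-! ### The six families -/

open QFlag in
theorem lemma2p1 (q : Set.Ioo (0 : ℝ) 1) (s : QFlag.Family) (φ ψ : Circle) :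
    QFlag.UnitarilyEquivalent (QFlag.rhoRep q s φ ψ) (QFlag.rhoRep q s 1 1) := by
  match s with
  | .zero =>
    -- There are no coordinates here, so `l` is an empty family and the gauge action alone absorbs
    -- both phases.
    refine unitarilyEquivalent_of_map_piMatrix _ _ _ φ ψ (fun _ => 1) ?_
    refine (map_torus _ φ ψ).trans ?_
    simp [piMatrix, torus_one_one]
  | .oneOne =>
    have hF := rescales_torusConj (q := q) ![ψ]
    have h : (T12 q (k := 1) 0 ψ * torus _ 1 (-(φ * ψ))).map (torusConj ![ψ]) =
        T12 q (k := 1) 0 1 * torus _ 1 (-(1 * 1)) * torus _ ψ φ := by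
      -- The block leaves `D(ψ, ψ⁻¹)`; multiplied by `D(1, -φψ)` this is `D(1, -1) D(ψ, φ)`.
      rw [Matrix.map_mul, hF.T12_map ψ 1 (by simp), map_torus, mul_assoc, mul_assoc,
        torus_mul_torus, torus_mul_torus]
      simp
    exact unitarilyEquivalent_of_map_piMatrix _ _ _ ψ φ ![ψ] h
  | .oneTwo =>
    have hF := rescales_torusConj (q := q) ![(φ * ψ)⁻¹]
    have h : (T23 q (k := 1) 0 (φ * ψ)⁻¹ * torus _ (-φ) 1).map (torusConj ![(φ * ψ)⁻¹]) =
        T23 q (k := 1) 0 (1 * 1)⁻¹ * torus _ (-1) 1 * torus _ φ (φ * ψ)⁻¹ := by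
      rw [Matrix.map_mul, hF.T23_map (φ * ψ)⁻¹ (1 * 1)⁻¹ (by simp), map_torus, mul_assoc,
        mul_assoc, torus_mul_torus, torus_mul_torus]
      simp
    exact unitarilyEquivalent_of_map_piMatrix _ _ _ φ (φ * ψ)⁻¹ _ h
  | .twoOne =>
    -- The first block leaves `D(φ, φ⁻¹)`, whose third entry is `1`; the condition at the second
    -- block is then `l 1 = (φψ)⁻¹ φ = ψ⁻¹`.
    have hF := rescales_torusConj (q := q) ![φ, ψ⁻¹]
    have h : (T12 q (k := 2) 0 φ * T23 q (k := 2) 1 (φ * ψ)⁻¹).map (torusConj ![φ, ψ⁻¹]) =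
        T12 q (k := 2) 0 1 * T23 q (k := 2) 1 (1 * 1)⁻¹ * torus _ φ (φ * ψ)⁻¹ := by
      rw [Matrix.map_mul, hF.T12_map φ 1 (by simp), mul_assoc,
        hF.torus_mul_T23 _ _ (φ * ψ)⁻¹ (1 * 1)⁻¹ (by simp)]
      simp [mul_assoc]
    exact unitarilyEquivalent_of_map_piMatrix _ _ _ φ (φ * ψ)⁻¹ _ h
  | .twoTwo =>
    -- Here the block with index `1` comes first and leaves `D(1, φψ)`, so the next condition is `l
    -- 0 = φψ · ψ⁻¹ = φ`. The signs cancel in each ratio of phases.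
    have hF := rescales_torusConj (q := q) ![φ, φ * ψ]
    have h : (T23 q (k := 2) 1 (-(φ * ψ)) * T12 q (k := 2) 0 (-ψ⁻¹)).map
          (torusConj ![φ, φ * ψ]) =
        T23 q (k := 2) 1 (-(1 * 1)) * T12 q (k := 2) 0 (-1⁻¹) * torus _ φ ψ := by
      rw [Matrix.map_mul, hF.T23_map (-(φ * ψ)) (-(1 * 1)) (by simp), mul_assoc,
        hF.torus_mul_T12 _ _ (-ψ⁻¹) (-1⁻¹) (by simp)]
      simp [mul_assoc]
    exact unitarilyEquivalent_of_map_piMatrix _ _ _ φ ψ _ h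
  | .three =>
    -- The blocks come in the order `2, 0, 1`. The torus element runs through `D(1, φ)`, `D(φ, 1)`,
    -- `D(φ, (φψ)⁻¹)`, which forces in turn `l 2 = φ`, `l 0 = φ`, `l 1 = (φψ)⁻¹`.
    have hF := rescales_torusConj (q := q) ![φ, (φ * ψ)⁻¹, φ]
    have h : (T23 q (k := 3) 2 φ * T12 q (k := 3) 0 1 * T23 q (k := 3) 1 ψ⁻¹).map
          (torusConj ![φ, (φ * ψ)⁻¹, φ]) =
        T23 q (k := 3) 2 1 * T12 q (k := 3) 0 1 * T23 q (k := 3) 1 1⁻¹ *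
          torus _ φ (φ * ψ)⁻¹ := by
      rw [Matrix.map_mul, Matrix.map_mul, hF.T23_map φ 1 (by simp), mul_assoc (T23 _ _ _),
        hF.torus_mul_T12 _ _ 1 1 (by simp), mul_assoc, mul_assoc (T12 _ _ _),
        hF.torus_mul_T23 _ _ ψ⁻¹ 1⁻¹ (by simp [mul_comm])]
      simp [mul_assoc, mul_comm φ⁻¹]
    exact unitarilyEquivalent_of_map_piMatrix _ _ _ φ (φ * ψ)⁻¹ _ h
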